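/- Let $f\colon A\to B$ be a finite map of noetherian commutative rings. Then $\ker f$ is nilpotent if and only if $\operatorname{Spec} B\to\operatorname{Spec} A$ is surjective, and if this holds, then $f$ is descendable: the unit $A$ of the derived category $D(A)$ belongs to the thick $\otimes$-ideal of $D(A)$ generated by $B$. Here a thick $\otimes$-ideal of $D(A)$ is a full triangulated subcategory that is closed under retracts and under $-\otimes_A^{\mathbb L}Y$ for every $Y\in D(A)$, and the one generated by $B$ is the smallest one containing $B$. -/

import Mathlib

open CategoryTheory MonoidalCategory

universe w u

noncomputable section

namespace DerivedDescent

variable {A : Type u} [CommRing A] [HasDerivedCategory.{w} (ModuleCat.{u} A)]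

/-- `IsDerivedTensor X Y Z` says that the object `Z` of the (unbounded) derived category `D(A)`
is a derived tensor product `X ⊗ᴸ Y`: it is represented by the total tensor product `L ⊗ K` of
a complex `L` representing `X` and a K-projective complex `K` representing `Y`. Every object of
`D(A)` is represented by a K-projective complex, and these are K-flat, so this determines `Z` up
to isomorphism. -/
def IsDerivedTensor (X Y Z : DerivedCategory (ModuleCat.{u} A)) : Prop :=
  ∃ L K : CochainComplex (ModuleCat.{u} A) ℤ, K.IsKProjective ∧
    Nonempty (DerivedCategory.Q.obj L ≅ X) ∧ Nonempty (DerivedCategory.Q.obj K ≅ Y) ∧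
    Nonempty (DerivedCategory.Q.obj (L ⊗ K) ≅ Z)

/-- A thick `⊗`-ideal of `D(A)`: a triangulated subcategory (closed under shifts, cones and
isomorphisms, and containing `0`) that is closed under retracts and under `- ⊗ᴸ Y` for every
object `Y` of `D(A)`. -/
structure IsThickTensorIdeal (P : ObjectProperty (DerivedCategory (ModuleCat.{u} A))) :
    Prop where
  isTriangulated : P.IsTriangulated
  isStableUnderRetracts : P.IsStableUnderRetracts
  tensor_mem : ∀ X Y Z : DerivedCategory (ModuleCat.{u} A),
    IsDerivedTensor X Y Z → P X → P Z

/-- The thick `⊗`-ideal of `D(A)` generated by an object `X`: the intersection of all the thick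
`⊗`-ideals that contain `X`. -/
def thickTensorIdeal (X : DerivedCategory (ModuleCat.{u} A)) :
    ObjectProperty (DerivedCategory (ModuleCat.{u} A)) :=
  fun Y => ∀ P : ObjectProperty (DerivedCategory (ModuleCat.{u} A)),
    IsThickTensorIdeal P → P X → P Y

/-- An `A`-module as an object of `D(A)` concentrated in degree `0`. -/
def ofModule (M : ModuleCat.{u} A) : DerivedCategory (ModuleCat.{u} A) :=
  (DerivedCategory.singleFunctor (ModuleCat.{u} A) 0).obj M

/-- A map `f : A → B` of commutative rings is descendable if the unit `A` of `D(A)` belongs to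
the thick `⊗`-ideal of `D(A)` generated by `B`, which is an `A`-module through `f`. -/
def IsDescendable {B : Type u} [CommRing B] (f : A →+* B) : Prop :=
  thickTensorIdeal (ofModule ((ModuleCat.restrictScalars f).obj (ModuleCat.of B B)))
    (ofModule (ModuleCat.of A A))

end DerivedDescent

end

noncomputable section

namespace DerivedDescent

/-! A finite map is integral, so by lying over the image of `Spec B` is `V(ker f)`. This is all of
`Spec A` iff `ker f` lies in the nilradical, that is, iff `ker f` is nilpotent, `A` being
noetherian. For descendability, let `P` be a thick tensor ideal containing `B`. Every `B`-module `N`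
lies in `P`, as a retract of `B ⊗ᴸ N` (`IsThickTensorIdeal.ofModule_mem`). Noetherian induction,
from larger primes to smaller, puts each `A ⧸ p` in `P`: for `q` over `p`, the module `B ⧸ q`
contains some `(A ⧸ p)ⁿ` with `n > 0`, and the cokernel is torsion, hence built from quotients by
larger primes (`ofModule_quotient_mem`). Finally `A` has a finite filtration with subquotients `A ⧸
p`. -/

/-- A finite module over a domain contains a free submodule of maximal rank. -/
lemma exists_injective_forall_smul_mem_range (R M : Type*)
    [CommRing R] [IsDomain R] [AddCommGroup M] [Module R M] [Module.Finite R M] :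
    ∃ g : (Fin (Module.finrank R M) → R) →ₗ[R] M, Function.Injective g ∧
      ∀ x, ∃ r : R, r ≠ 0 ∧ r • x ∈ LinearMap.range g := by
  obtain ⟨v, hv⟩ := exists_linearIndependent_of_le_finrank (R := R) (M := M) le_rfl
  refine ⟨Fintype.linearCombination R v, hv.fintypeLinearCombination_injective,
    fun x => ?_⟩
  -- By additivity of rank, the quotient by the span of `v` has rank zero, so it is torsion.
  have h := Submodule.finrank_quotient_add_finrank (LinearMap.range (Fintype.linearCombination R v))
  rw [Fintype.range_linearCombination, finrank_span_eq_card hv, Fintype.card_fin,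
    Nat.add_eq_right, Module.finrank_eq_zero_iff] at h
  obtain ⟨r, hr, hx⟩ := h (Submodule.Quotient.mk x)
  rw [← Submodule.Quotient.mk_smul, Submodule.Quotient.mk_eq_zero] at hx
  exact ⟨r, hr, by rwa [Fintype.range_linearCombination]⟩

variable {A : Type u} [CommRing A]

/-! ### Tensor products of complexes concentrated in degree `0` -/

open HomologicalComplex in
lemma isZero_single_tensor (X Y : ModuleCat.{u} A) (i j : ℤ) (h : ¬ (i = 0 ∧ j = 0)) :
    Limits.IsZero
      (((single (ModuleCat.{u} A) (ComplexShape.up ℤ) 0).obj X).X i ⊗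
        ((single (ModuleCat.{u} A) (ComplexShape.up ℤ) 0).obj Y).X j) := by
  by_cases hi : i = 0
  · exact (tensorLeft _).map_isZero (isZero_single_obj_X _ _ _ _ (fun hj => h ⟨hi, hj⟩))
  · exact (tensorRight _).map_isZero (isZero_single_obj_X _ _ _ _ hi)

open HomologicalComplex in
lemma isZero_single_tensor_single_X (X Y : ModuleCat.{u} A) (k : ℤ) (hk : k ≠ 0) :
    Limits.IsZero (((single (ModuleCat.{u} A) (ComplexShape.up ℤ) 0).obj X ⊗
      (single (ModuleCat.{u} A) (ComplexShape.up ℤ) 0).obj Y).X k) := by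
  rw [Limits.IsZero.iff_id_eq_zero]
  apply mapBifunctor.hom_ext
  intro i j hij
  apply (isZero_single_tensor X Y i j _).eq_of_src
  rintro ⟨rfl, rfl⟩
  exact hk (hij.symm.trans (by simp))

open HomologicalComplex in
/-- The component in degree `0` of `singleTensorDesc`. -/
def singleTensorDescZero {X Y Z : ModuleCat.{u} A} (a : X ⊗ Y ⟶ Z) :
    ((single (ModuleCat.{u} A) (ComplexShape.up ℤ) 0).obj X ⊗
      (single (ModuleCat.{u} A) (ComplexShape.up ℤ) 0).obj Y).X 0 ⟶ Z :=
  mapBifunctorDesc fun i j _ =>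
    if h : i = 0 ∧ j = 0 then
      ((singleObjXIsoOfEq _ 0 X i h.1).hom ⊗ₘ (singleObjXIsoOfEq _ 0 Y j h.2).hom) ≫ a
    else 0

open HomologicalComplex in
lemma ι_singleTensorDescZero {X Y Z : ModuleCat.{u} A} (a : X ⊗ Y ⟶ Z) :
    ιTensorObj ((single (ModuleCat.{u} A) (ComplexShape.up ℤ) 0).obj X)
      ((single (ModuleCat.{u} A) (ComplexShape.up ℤ) 0).obj Y) 0 0 0 (zero_add 0) ≫
        singleTensorDescZero a =
      ((singleObjXSelf (ComplexShape.up ℤ) 0 X).hom ⊗ₘ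
        (singleObjXSelf (ComplexShape.up ℤ) 0 Y).hom) ≫ a := by
  unfold singleTensorDescZero
  erw [ι_mapBifunctorDesc]
  rw [dif_pos ⟨rfl, rfl⟩]
  rfl

open HomologicalComplex in
/-- A morphism `X ⊗ Y ⟶ Z` of modules induces a morphism from the tensor product of the
complexes concentrated in degree `0`. -/
def singleTensorDesc {X Y Z : ModuleCat.{u} A} (a : X ⊗ Y ⟶ Z) :
    ((single (ModuleCat.{u} A) (ComplexShape.up ℤ) 0).obj X ⊗
      (single (ModuleCat.{u} A) (ComplexShape.up ℤ) 0).obj Y) ⟶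
        (single (ModuleCat.{u} A) (ComplexShape.up ℤ) 0).obj Z :=
  -- The incoming differential starts in degree `-1`, where the tensor product vanishes.
  mkHomToSingle (singleTensorDescZero a) fun k hk =>
    (isZero_single_tensor_single_X X Y k (by
      simp only [ComplexShape.up_Rel] at hk; omega)).eq_of_src _ _

open HomologicalComplex in
lemma ιTensorObj_whiskerRight {K L : CochainComplex (ModuleCat.{u} A) ℤ} (f : K ⟶ L)
    (M : CochainComplex (ModuleCat.{u} A) ℤ) (i j k : ℤ) (h : i + j = k) :
    ιTensorObj K M i j k h ≫ (f ▷ M).f k = (f.f i ▷ M.X j) ≫ ιTensorObj L M i j k h := by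
  refine (ι_mapBifunctorMap f (𝟙 M) (curriedTensor _) (ComplexShape.up ℤ) i j k h).trans ?_
  erw [id_f, ((curriedTensor (ModuleCat.{u} A)).obj (L.X i)).map_id, Category.id_comp]
  rfl

open HomologicalComplex in
lemma leftUnitor_inv_f (K : CochainComplex (ModuleCat.{u} A) ℤ) (i : ℤ) :
    (λ_ K).inv.f i = (λ_ (K.X i)).inv ≫
      ((singleObjXSelf (ComplexShape.up ℤ) 0 (𝟙_ (ModuleCat.{u} A))).inv ▷ K.X i) ≫
        ιTensorObj (tensorUnit _ _) K 0 i i (zero_add i) :=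
  leftUnitor'_inv K i

-- The unit law of an action, transported from modules to complexes.
open HomologicalComplex in
lemma leftUnitor_inv_whiskerRight_singleTensorDesc {X Y : ModuleCat.{u} A}
    (η : 𝟙_ (ModuleCat.{u} A) ⟶ X) (a : X ⊗ Y ⟶ Y) (h : (λ_ Y).inv ≫ η ▷ Y ≫ a = 𝟙 Y) :
    (λ_ ((single (ModuleCat.{u} A) (ComplexShape.up ℤ) 0).obj Y)).inv ≫
      ((single (ModuleCat.{u} A) (ComplexShape.up ℤ) 0).map η ▷
        (single (ModuleCat.{u} A) (ComplexShape.up ℤ) 0).obj Y) ≫ singleTensorDesc a = 𝟙 _ := by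
  apply HomologicalComplex.to_single_hom_ext
  have h3 : (singleTensorDesc a).f 0 = singleTensorDescZero a ≫
    (singleObjXSelf (ComplexShape.up ℤ) 0 Y).inv := mkHomToSingle_f _ _
  rw [comp_f, comp_f, id_f, h3, leftUnitor_inv_f]
  simp only [Category.assoc]
  rw [reassoc_of% ιTensorObj_whiskerRight ((single (ModuleCat.{u} A) (ComplexShape.up ℤ) 0).map η),
    reassoc_of% ι_singleTensorDescZero a, single_map_f_self,
    MonoidalCategory.tensorHom_def]
  simp only [MonoidalCategory.comp_whiskerRight, Category.assoc]
  have e (Z : ModuleCat.{u} A) (W : ModuleCat.{u} A) {V : ModuleCat.{u} A} (g : Z ⊗ W ⟶ V) :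
      (singleObjXSelf (ComplexShape.up ℤ) 0 Z).inv ▷ W ≫
        (singleObjXSelf (ComplexShape.up ℤ) 0 Z).hom ▷ W ≫ g = g := by
    rw [← MonoidalCategory.comp_whiskerRight_assoc, Iso.inv_hom_id,
      MonoidalCategory.id_whiskerRight, Category.id_comp]
  rw [e, e, ← MonoidalCategory.whisker_exchange_assoc,
    ← MonoidalCategory.leftUnitor_inv_naturality_assoc, reassoc_of% h, Iso.hom_inv_id]

/-- If an isomorphism `K ≅ Y` factors through `Z`, then `Y` is a retract of `Z`. -/
def retractOfFactorization {C : Type*} [Category C] {K Y Z : C} (e : K ≅ Y) (i : K ⟶ Z)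
    (r : Z ⟶ Y) (h : i ≫ r = e.hom) : Retract Y Z where
  i := e.inv ≫ i
  r := r
  retract := by rw [Category.assoc, h, Iso.inv_hom_id]

/-! ### Modules over `B` in a thick tensor ideal -/

variable [HasDerivedCategory.{w} (ModuleCat.{u} A)]

/-- `η` and `a` exhibit `Y` as a retract of `X ⊗ᴸ Y`. Only the unit law of the action is needed, not
associativity. -/
lemma IsThickTensorIdeal.ofModule_mem
    {P : ObjectProperty (DerivedCategory (ModuleCat.{u} A))} (hP : IsThickTensorIdeal P)
    {X Y : ModuleCat.{u} A} (hX : P (ofModule X))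
    (η : 𝟙_ (ModuleCat.{u} A) ⟶ X) (a : X ⊗ Y ⟶ Y) (h : (λ_ Y).inv ≫ η ▷ Y ≫ a = 𝟙 Y) :
    P (ofModule Y) := by
  let S := HomologicalComplex.single (ModuleCat.{u} A) (ComplexShape.up ℤ) 0
  obtain ⟨K, hK, π, e, he⟩ : ∃ (K : CochainComplex (ModuleCat.{u} A) ℤ) (_ : K.IsKProjective)
      (π : K ⟶ S.obj Y) (e : DerivedCategory.Q.obj K ≅ ofModule Y),
        e.hom = DerivedCategory.Q.map π := by
    let e := asIso (DerivedCategory.Q.map (projectiveResolution Y).π')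
    exact ⟨_, CochainComplex.isKProjective_of_projective _ 0, (projectiveResolution Y).π', e, rfl⟩
  have hZ : P (DerivedCategory.Q.obj (S.obj X ⊗ K)) :=
    hP.tensor_mem (ofModule X) (ofModule Y) _
      ⟨S.obj X, K, hK, ⟨Iso.refl _⟩, ⟨e⟩, ⟨Iso.refl _⟩⟩ hX
  -- With `Y` resolved by `K`, the composite `K ⟶ X ⊗ K ⟶ X ⊗ Y ⟶ Y` is the quasi-isomorphism `π`.
  have hcomp : ((λ_ K).inv ≫ (S.map η ▷ K)) ≫ (S.obj X ◁ π) ≫ singleTensorDesc a = π := by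
    have hnat : (λ_ K).inv ≫ S.obj (𝟙_ _) ◁ π = π ≫ (λ_ (S.obj Y)).inv :=
      (MonoidalCategory.leftUnitor_inv_naturality π).symm
    rw [Category.assoc, ← MonoidalCategory.whisker_exchange_assoc, reassoc_of% hnat]
    erw [leftUnitor_inv_whiskerRight_singleTensorDesc η a h]
    rw [Category.comp_id]
  have := hP.isStableUnderRetracts
  exact P.prop_of_retract (retractOfFactorization e
    (DerivedCategory.Q.map ((λ_ K).inv ≫ (S.map η ▷ K)))
    (DerivedCategory.Q.map ((S.obj X ◁ π) ≫ singleTensorDesc a))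
    ((DerivedCategory.Q.map_comp _ _).symm.trans
      ((congrArg DerivedCategory.Q.map hcomp).trans he.symm))) hZ

/-- If `B` belongs to a thick tensor ideal, so does every `B`-module. -/
lemma IsThickTensorIdeal.ofModule_mem_of_module
    {P : ObjectProperty (DerivedCategory (ModuleCat.{u} A))} (hP : IsThickTensorIdeal P)
    {B : Type u} [CommRing B] [Algebra A B] (hB : P (ofModule (ModuleCat.of A B)))
    (N : Type u) [AddCommGroup N] [Module A N] [Module B N] [IsScalarTower A B N] :
    P (ofModule (ModuleCat.of A N)) := by
  refine hP.ofModule_mem (X := ModuleCat.of A B) hB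
    (ModuleCat.ofHom (Algebra.linearMap A B))
    (ModuleCat.ofHom (TensorProduct.lift (LinearMap.mk₂ A (fun (b : B) (n : N) => b • n)
      (fun _ _ _ => add_smul _ _ _) (fun _ _ _ => smul_assoc _ _ _)
      (fun _ _ _ => smul_add _ _ _) (fun a b n => smul_algebra_smul_comm a b n)))) ?_
  ext n
  change (algebraMap A B 1) • n = n
  rw [map_one, one_smul]

/-! ### Dévissage of finite modules to the quotients `A ⧸ p` -/

section Triangulated

variable {P : ObjectProperty (DerivedCategory (ModuleCat.{u} A))}

lemma ofModule_mem_of_linearEquiv [P.IsClosedUnderIsomorphisms] {M N : Type u}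
    [AddCommGroup M] [Module A M] [AddCommGroup N] [Module A N] (e : M ≃ₗ[A] N)
    (h : P (ofModule (ModuleCat.of A N))) :
    P (ofModule (ModuleCat.of A M)) :=
  P.prop_of_iso ((DerivedCategory.singleFunctor _ 0).mapIso e.symm.toModuleIso) h

lemma ofModule_mem_of_section [P.IsStableUnderRetracts] {M N : Type u}
    [AddCommGroup M] [Module A M] [AddCommGroup N] [Module A N] (i : M →ₗ[A] N) (r : N →ₗ[A] M)
    (hir : r ∘ₗ i = LinearMap.id) (h : P (ofModule (ModuleCat.of A N))) :
    P (ofModule (ModuleCat.of A M)) :=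
  P.prop_of_retract ((Retract.mk (ModuleCat.ofHom i) (ModuleCat.ofHom r)
    (by rw [← ModuleCat.ofHom_comp, hir, ModuleCat.ofHom_id])).map
      (DerivedCategory.singleFunctor _ 0)) h

variable [P.IsTriangulated]

lemma ofModule_mem_of_subsingleton (N : Type u) [AddCommGroup N] [Module A N] [Subsingleton N]
    [P.IsClosedUnderIsomorphisms] :
    P (ofModule (ModuleCat.of A N)) :=
  P.prop_of_isZero ((DerivedCategory.singleFunctor _ 0).map_isZero
    (ModuleCat.isZero_of_subsingleton _))

section Exact

variable {M₁ M₂ M₃ : Type u} [AddCommGroup M₁] [Module A M₁]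
  [AddCommGroup M₂] [Module A M₂] [AddCommGroup M₃] [Module A M₃]
  {i : M₁ →ₗ[A] M₂} {p : M₂ →ₗ[A] M₃}

lemma exists_distinguished_ofModule (hi : Function.Injective i) (hp : Function.Surjective p)
    (h : Function.Exact i p) :
    ∃ T ∈ Pretriangulated.distinguishedTriangles (C := DerivedCategory (ModuleCat.{u} A)),
      T.obj₁ = ofModule (ModuleCat.of A M₁) ∧ T.obj₂ = ofModule (ModuleCat.of A M₂) ∧
      T.obj₃ = ofModule (ModuleCat.of A M₃) := by
  let S : ShortComplex (ModuleCat.{u} A) := ShortComplex.mk (ModuleCat.ofHom i)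
    (ModuleCat.ofHom p) (by
      rw [← ModuleCat.ofHom_comp, h.linearMap_comp_eq_zero, ModuleCat.ofHom_zero])
  have hS : S.ShortExact :=
    { exact := (ShortComplex.ShortExact.moduleCat_exact_iff_function_exact S).mpr h
      mono_f := (ModuleCat.mono_iff_injective _).mpr hi
      epi_g := (ModuleCat.epi_iff_surjective _).mpr hp }
  exact ⟨_, hS.singleTriangle_distinguished, rfl, rfl, rfl⟩

variable [P.IsClosedUnderIsomorphisms]

lemma ofModule_mem_of_exact₂ (hi : Function.Injective i) (hp : Function.Surjective p)
    (h : Function.Exact i p) (h₁ : P (ofModule (ModuleCat.of A M₁)))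
    (h₃ : P (ofModule (ModuleCat.of A M₃))) : P (ofModule (ModuleCat.of A M₂)) := by
  obtain ⟨T, hT, e₁, e₂, e₃⟩ := exists_distinguished_ofModule hi hp h
  exact e₂ ▸ P.ext_of_isTriangulatedClosed₂ T hT (e₁ ▸ h₁) (e₃ ▸ h₃)

lemma ofModule_mem_of_exact₁ (hi : Function.Injective i) (hp : Function.Surjective p)
    (h : Function.Exact i p) (h₂ : P (ofModule (ModuleCat.of A M₂)))
    (h₃ : P (ofModule (ModuleCat.of A M₃))) : P (ofModule (ModuleCat.of A M₁)) := by
  obtain ⟨T, hT, e₁, e₂, e₃⟩ := exists_distinguished_ofModule hi hp h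
  exact e₁ ▸ P.ext_of_isTriangulatedClosed₁ T hT (e₂ ▸ h₂) (e₃ ▸ h₃)

end Exact

variable [P.IsStableUnderRetracts] [IsNoetherianRing A]

/-- Every finite module is built from the quotients of `A` by primes. -/
lemma ofModule_mem_of_forall_quotient
    (h : ∀ p : PrimeSpectrum A, P (ofModule (ModuleCat.of A (A ⧸ p.asIdeal))))
    (M : Type u) [AddCommGroup M] [Module A M] [Module.Finite A M] :
    P (ofModule (ModuleCat.of A M)) := by
  have hM : Module.Finite A M := inferInstance
  induction hM using IsNoetherianRing.induction_on_isQuotientEquivQuotientPrime A with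
  | subsingleton N => exact ofModule_mem_of_subsingleton N
  | quotient N p e => exact ofModule_mem_of_linearEquiv e (h p)
  | exact N₁ N₂ N₃ f g hf hg hfg h₁ h₃ => exact ofModule_mem_of_exact₂ hf hg hfg h₁ h₃

/-- A finite module that is annihilated by a prime `p` and has no element with annihilator `p`
is built from the quotients of `A` by primes strictly larger than `p`. -/
lemma ofModule_mem_of_torsion (p : PrimeSpectrum A)
    (ih : ∀ p', p < p' → P (ofModule (ModuleCat.of A (A ⧸ p'.asIdeal))))
    (M : Type u) [AddCommGroup M] [Module A M] [Module.Finite A M]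
    (hp : ∀ a ∈ p.asIdeal, ∀ x : M, a • x = 0)
    (ht : ∀ x : M, ∃ a ∉ p.asIdeal, a • x = 0) : P (ofModule (ModuleCat.of A M)) := by
  have hM : Module.Finite A M := inferInstance
  induction hM using IsNoetherianRing.induction_on_isQuotientEquivQuotientPrime A with
  | subsingleton N => exact ofModule_mem_of_subsingleton N
  | quotient N p' e =>
    refine ofModule_mem_of_linearEquiv e (ih p' ?_)
    -- The generator of `N` corresponding to `1` has annihilator `p'`: `hp` gives `p ≤ p'`, and `ht`
    -- at this generator makes the inclusion strict.
    have key (a : A) : a ∈ p'.asIdeal ↔ a • e.symm (Ideal.Quotient.mk _ 1) = 0 := by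
      rw [← map_smul, LinearEquiv.map_eq_zero_iff, ← Ideal.Quotient.eq_zero_iff_mem,
        Algebra.smul_def, map_one, mul_one]
      rfl
    obtain ⟨a, ha, hx⟩ := ht (e.symm (Ideal.Quotient.mk _ 1))
    refine lt_of_le_not_ge (fun b hb => (key b).mpr (hp b hb _)) fun hle => ha (hle ?_)
    exact (key a).mpr hx
  | exact N₁ N₂ N₃ f g hf hg hfg h₁ h₃ =>
    refine ofModule_mem_of_exact₂ hf hg hfg (h₁ ?_ ?_) (h₃ ?_ ?_)
    · exact fun a ha x => hf (by rw [map_smul, hp a ha, map_zero])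
    · exact fun x => (ht (f x)).imp fun a ha =>
        ⟨ha.1, hf (by rw [map_smul, ha.2, map_zero])⟩
    · intro a ha x
      obtain ⟨y, rfl⟩ := hg x
      rw [← map_smul, hp a ha, map_zero]
    · intro x
      obtain ⟨y, rfl⟩ := hg x
      exact (ht y).imp fun a ha => ⟨ha.1, by rw [← map_smul, ha.2, map_zero]⟩

/-- The quotient of `A` by a prime `p` is built from any nonzero finite torsion-free
`A ⧸ p`-module and the quotients of `A` by primes strictly larger than `p`. -/
lemma ofModule_quotient_mem (p : PrimeSpectrum A)
    (ih : ∀ p', p < p' → P (ofModule (ModuleCat.of A (A ⧸ p'.asIdeal))))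
    (M : Type u) [AddCommGroup M] [Module A M] [Module.Finite A M] [Nontrivial M]
    [Module (A ⧸ p.asIdeal) M] [IsScalarTower A (A ⧸ p.asIdeal) M]
    [Module.IsTorsionFree (A ⧸ p.asIdeal) M] (hM : P (ofModule (ModuleCat.of A M))) :
    P (ofModule (ModuleCat.of A (A ⧸ p.asIdeal))) := by
  have : Module.Finite (A ⧸ p.asIdeal) M := Module.Finite.of_restrictScalars_finite A _ _
  obtain ⟨g, hg, ht⟩ := exists_injective_forall_smul_mem_range (A ⧸ p.asIdeal) M
  have hpos : 0 < Module.finrank (A ⧸ p.asIdeal) M := Module.finrank_pos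
  have smul_eq (a : A) (x : M) : Ideal.Quotient.mk p.asIdeal a • x = a • x :=
    algebraMap_smul (A ⧸ p.asIdeal) a x
  let g' := g.restrictScalars A
  have hquot : P (ofModule (ModuleCat.of A (M ⧸ LinearMap.range g'))) := by
    refine ofModule_mem_of_torsion p ih _ ?_ ?_
    · intro a ha x
      obtain ⟨x, rfl⟩ := Submodule.Quotient.mk_surjective _ x
      rw [← Submodule.Quotient.mk_smul, ← smul_eq, Ideal.Quotient.eq_zero_iff_mem.mpr ha,
        zero_smul, Submodule.Quotient.mk_zero]
    · intro x
      obtain ⟨x, rfl⟩ := Submodule.Quotient.mk_surjective _ x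
      obtain ⟨r, hr, y, hy⟩ := ht x
      obtain ⟨a, rfl⟩ := Ideal.Quotient.mk_surjective r
      refine ⟨a, fun ha => hr (Ideal.Quotient.eq_zero_iff_mem.mpr ha), ?_⟩
      rw [← Submodule.Quotient.mk_smul, Submodule.Quotient.mk_eq_zero, ← smul_eq]
      exact ⟨y, hy⟩
  have hfree := ofModule_mem_of_exact₁ (P := P) (i := g') (p := (LinearMap.range g').mkQ) hg
    (Submodule.mkQ_surjective _) (LinearMap.exact_map_mkQ_range g') hM hquot
  -- Positive rank makes `A ⧸ p` a direct summand of the free module.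
  exact ofModule_mem_of_section (LinearMap.single A (fun _ => A ⧸ p.asIdeal) ⟨0, hpos⟩)
    (LinearMap.proj ⟨0, hpos⟩) (LinearMap.proj_comp_single_same A _ _) hfree

end Triangulated

lemma isDescendable_of_comap_surjective [IsNoetherianRing A] {B : Type u} [CommRing B]
    (f : A →+* B) (hf : f.Finite) (hs : Function.Surjective (PrimeSpectrum.comap f)) :
    IsDescendable f := by
  intro P hP hB
  let := f.toAlgebra
  have hB' : P (ofModule (ModuleCat.of A B)) := hB
  have := hP.isTriangulated
  have := hP.isStableUnderRetracts
  have hfin : Module.Finite A B := hf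
  have hwf : WellFoundedGT (PrimeSpectrum A) :=
    StrictMono.wellFoundedGT (f := PrimeSpectrum.asIdeal) fun _ _ h => h
  have hprime (p : PrimeSpectrum A) : P (ofModule (ModuleCat.of A (A ⧸ p.asIdeal))) := by
    induction p using WellFoundedGT.induction with
    | ind p ih =>
      obtain ⟨q, hq⟩ := hs p
      -- This makes `B ⧸ q` a domain containing `A ⧸ p`, hence torsion-free over it.
      have : q.asIdeal.LiesOver p.asIdeal := ⟨by rw [← hq]; rfl⟩
      exact ofModule_quotient_mem p ih (B ⧸ q.asIdeal) (hP.ofModule_mem_of_module hB' _)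
  exact ofModule_mem_of_forall_quotient hprime A

end DerivedDescent

end

theorem mainTheorem2 {A B : Type u} [CommRing A] [CommRing B]
    [IsNoetherianRing A] [IsNoetherianRing B] [HasDerivedCategory.{w} (ModuleCat.{u} A)]
    (f : A →+* B) (hf : f.Finite) :
    (IsNilpotent (RingHom.ker f) ↔ Function.Surjective (PrimeSpectrum.comap f)) ∧
      (IsNilpotent (RingHom.ker f) → DerivedDescent.IsDescendable f) := by
  have h : IsNilpotent (RingHom.ker f) ↔ Function.Surjective (PrimeSpectrum.comap f) := by
    rw [Ideal.FG.isNilpotent_iff_le_nilradical (IsNoetherian.noetherian _)]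
    constructor
    · intro hker
      -- Lying over applies to the injective integral map `A ⧸ ker f → B`.
      have hint : f.kerLift.IsIntegral := hf.to_isIntegral.tower_top (Ideal.Quotient.mk _) f.kerLift
      exact (PrimeSpectrum.comap_quotientMk_bijective_of_le_nilradical hker).2.comp
        (hint.comap_surjective f.kerLift_injective)
    · intro hs
      rw [nilradical_eq_sInf]
      refine le_sInf fun p hp => ?_
      obtain ⟨q, hq⟩ := hs ⟨p, hp⟩
      have hq' : q.asIdeal.comap f = p := congrArg PrimeSpectrum.asIdeal hq
      exact hq' ▸ Ideal.ker_le_comap f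
  exact ⟨h, fun hn => DerivedDescent.isDescendable_of_comap_surjective f hf (h.mp hn)⟩
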